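/- Conventions. Let $K\subset\mathbb{C}$ be closed. A set $E\subset\mathbb C$ is polar if $\iint\log\frac1{|z-t|}\,d\mu(z)\,d\mu(t)=+\infty$ for every probability measure $\mu$ carried by a compact subset of $E$. A weight on $K$ is a lower semicontinuous function $Q:K\to(-\infty,+\infty]$ such that $\{z\in K: Q(z)<\infty\}$ is nonpolar; put $w=e^{-Q}$. It is weakly admissible if $\liminf_{z\in K,\,|z|\to\infty}\bigl(Q(z)-\log|z|\bigr)>-\infty$ (no condition if $K$ is bounded). For $z_1,\dots,z_k\in K$ let $$|VDM_k^Q(z_1,\dots,z_k)|=\prod_{1\le i<j\le k}|z_i-z_j|\,w(z_i)\,w(z_j),$$ and, for $k\ge2$, let $$\delta_k^Q(K)=\sup_{z_1,\dots,z_k\in K}|VDM_k^Q(z_1,\dots,z_k)|^{2/k(k-1)},\qquad \delta^Q(K)=\lim_{k\to\infty}\delta_k^Q(K).$$ For a positive locally finite Borel measure $\nu$ on $K$ (that is, finite on the compact subsets of $K$) let $$Z_k^Q=\int_{K^k}|VDM_k^Q(z_1,\dots,z_k)|^2\,d\nu(z_1)\cdots d\nu(z_k).$$ The triple $(K,\nu,Q)$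 satisfies the weighted Bernstein–Markov property if there are finite constants $M_k$ with $\limsup_{k\to\infty}M_k^{1/k}=1$ such that $\sup_K|e^{-kQ}p|\le M_k\,\|e^{-kQ}p\|_{L^2(\nu)}$ for every $k$ and every complex polynomial $p$ of degree at most $k$ in the complex variable $z$. Proposition. Let $K\subset\mathbb{C}$ be closed and nonpolar, $\nu$ a positive locally finite Borel measure on $K$, and $Q$ a weight on $K$. Assume that one of the following holds: (i) $\nu(K)<\infty$ and $Q$ is weakly admissible; (ii) $\nu$ has infinite mass in every neighborhood of infinity, i.e. $\nu(\{z\in K:|z|>R\})=\infty$ for all $R$, and there is a continuous function $\epsilon:K\to[0,\infty)$ with $\epsilon(z)\to0$ as $z\to\infty$, $z\in K$, such that $\int_K\epsilon^a\,d\nu<\infty$ for some $a>0$, and $Q(z)-\log|z|\ge-\log\epsilon(z)$ for all $z\in K$ with $|z|$ sufficiently large (where $-\log 0=+\infty$). Assume that $(K,\nu,Q)$ satisfies the weighted Bernstein–Markov property. Then the limit $\delta^Q(K)$ exists, $0<\delta^Q(K)<\infty$, and $$\lim_{k\to\infty}\bigl(Z_k^Q\bigr)^{1/k(k-1)}=\delta^Q(K).$$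 -/

import Mathlib

open scoped ENNReal NNReal Topology

noncomputable section

namespace WeightedPotential

open MeasureTheory Filter

/-- The logarithmic kernel `log (1 / |z - t|)`, equal to `+∞` on the diagonal. -/
def logKernel (z t : ℂ) : EReal :=
  -ENNReal.log (edist z t)

/-- The logarithmic energy `∬ log (1 / |z - t|) dμ(z) dμ(t)`, as the integral of the positive part
minus the integral of the negative part. For a finite measure with compact support the latter is
finite, so that the energy is a well-defined element of `(-∞, +∞]`. -/
def logEnergy (μ : Measure ℂ) : EReal :=
  ((∫⁻ z, ∫⁻ t, (logKernel z t).toENNReal ∂μ ∂μ : ℝ≥0∞) : EReal) -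
    ((∫⁻ z, ∫⁻ t, (-logKernel z t).toENNReal ∂μ ∂μ : ℝ≥0∞) : EReal)

/-- A (Borel) set is polar if every probability measure carried by one of its compact subsets has
infinite logarithmic energy. -/
def IsPolar (E : Set ℂ) : Prop :=
  ∀ C : Set ℂ, C ⊆ E → IsCompact C →
    ∀ μ : Measure ℂ, IsProbabilityMeasure μ → μ Cᶜ = 0 → logEnergy μ = ⊤

/-- The filter `z → ∞`, `z ∈ K`. It is the trivial filter when `K` is bounded. -/
def atInfinity (K : Set ℂ) : Filter ℂ :=
  Bornology.cobounded ℂ ⊓ 𝓟 K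

/-- A weight on `K`: a lower semicontinuous function `Q : K → (-∞, +∞]` which is finite on a
nonpolar set. Only the values of `Q` on `K` matter. -/
structure IsWeight (K : Set ℂ) (Q : ℂ → EReal) : Prop where
  ne_bot : ∀ z ∈ K, Q z ≠ ⊥
  lsc : LowerSemicontinuousOn Q K
  nonpolar : ¬ IsPolar {z ∈ K | Q z < ⊤}

/-- Weak admissibility: `liminf (Q z - log |z|) > -∞` as `z → ∞` in `K`. This holds trivially for
bounded `K`, and the liminf may be `+∞`: admissible weights are weakly admissible. -/
def WeaklyAdmissible (K : Set ℂ) (Q : ℂ → EReal) : Prop :=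
  IsWeight K Q ∧
    ⊥ < liminf (fun z => Q z - ((Real.log ‖z‖ : ℝ) : EReal)) (atInfinity K)

/-- `ε` is a nonnegative continuous function on `K` that tends to `0` at infinity, with
`∫_K ε ^ a dν < ∞` for some `a > 0` and `Q z - log |z| ≥ - log (ε z)` for all `z ∈ K` near
infinity, where `- log 0 = +∞`. -/
structure ControlsAtInfinity (K : Set ℂ) (ν : Measure ℂ) (Q : ℂ → EReal) (ε : ℂ → ℝ≥0) :
    Prop where
  continuousOn : ContinuousOn ε K
  tendsto_zero : Tendsto ε (atInfinity K) (𝓝 0)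
  integral_lt_top : ∃ a : ℝ, 0 < a ∧ ∫⁻ z in K, (ε z : ℝ≥0∞) ^ a ∂ν < ⊤
  growth : ∀ᶠ z in atInfinity K,
    -ENNReal.log (ε z : ℝ≥0∞) ≤ Q z - ((Real.log ‖z‖ : ℝ) : EReal)

/-- `w = e^{-Q}`, with `w = 0` where `Q = +∞`. -/
def weight (Q : ℂ → EReal) (z : ℂ) : ℝ≥0∞ :=
  EReal.exp (-Q z)

/-- The weighted Bernstein–Markov property: there are finite constants `M k` with
`limsup (M k) ^ (1 / k) = 1` and `‖e^{-kQ} p‖_K ≤ M k * ‖e^{-kQ} p‖_{L²(ν)}` for every `k` and every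
complex polynomial `p` of degree at most `k`. The norms take values in `[0, +∞]`. -/
def BernsteinMarkov (K : Set ℂ) (ν : Measure ℂ) (Q : ℂ → EReal) : Prop :=
  ∃ M : ℕ → ℝ≥0,
    limsup (fun k : ℕ => (M k : ℝ≥0∞) ^ (1 / (k : ℝ))) atTop = 1 ∧
    ∀ (k : ℕ) (p : Polynomial ℂ), p.natDegree ≤ k →
      (⨆ z ∈ K, weight Q z ^ k * ‖p.eval z‖ₑ) ≤
        (M k : ℝ≥0∞) * (∫⁻ z in K, (weight Q z ^ k * ‖p.eval z‖ₑ) ^ 2 ∂ν) ^ (1 / 2 : ℝ)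

/-- The absolute value of the weighted Vandermonde, `∏_{i < j} |z_i - z_j| w(z_i) w(z_j)`. -/
def absVDM (Q : ℂ → EReal) {k : ℕ} (z : Fin k → ℂ) : ℝ≥0∞ :=
  ∏ i : Fin k, ∏ j ∈ Finset.Ioi i, edist (z i) (z j) * weight Q (z i) * weight Q (z j)

/-- The `k`-th weighted diameter (meaningful for `k ≥ 2`). -/
def weightedDiameter (K : Set ℂ) (Q : ℂ → EReal) (k : ℕ) : ℝ≥0∞ :=
  ⨆ (z : Fin k → ℂ) (_ : ∀ i, z i ∈ K), absVDM Q z ^ (2 / ((k : ℝ) * ((k : ℝ) - 1)))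

/-- The weighted transfinite diameter, the limit of the `k`-th weighted diameters. It is written as
a limsup to be defined in all cases. -/
def transfiniteDiameter (K : Set ℂ) (Q : ℂ → EReal) : ℝ≥0∞ :=
  limsup (fun k : ℕ => weightedDiameter K Q k) atTop

/-- The `L²` normalization constant `∫_{K^k} |VDM(z_1, …, z_k)|² dν(z_1) ⋯ dν(z_k)`. -/
def normalizationConstant (K : Set ℂ) (ν : Measure ℂ) [SigmaFinite ν] (Q : ℂ → EReal) (k : ℕ) :
    ℝ≥0∞ :=
  ∫⁻ z in {z : Fin k → ℂ | ∀ i, z i ∈ K}, absVDM Q z ^ 2 ∂(Measure.pi fun _ : Fin k => ν)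

end WeightedPotential

end

noncomputable section

namespace WeightedPotential

open MeasureTheory Filter

/-! Write k = m + 1 and δ_k for `weightedDiameter K Q k`. As a function of any one of its k points,
the weighted Vandermonde is the modulus of a weighted polynomial e^{-mQ} p with deg p = m, times a
factor free of that point (`sqVDM_update`). The estimates for Z_k therefore proceed one variable at
a time.

The sequence δ_k decreases, by deleting each point in turn and multiplying
(`weightedDiameter_succ_le`), so it converges. The limit is finite because e^{-Q}(1 + |z|) is
bounded on K and |z - t| ≤ (1 + |z|)(1 + |t|). It is positive because nonpolarity yields a measure
of bounded potential on a compact set where Q is bounded. Averaging against it finds a point where ∏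
|t - a_i| is at least c^{-m} ∏ (1 + |a_i|) (`exists_bernsteinWalsh`), and points chosen greedily in
this way keep the Vandermonde large.

Bernstein–Markov in each variable gives δ_k^{k(k-1)} ≤ M_m^{2k} Z_k
(`sqVDM_le_normalizationConstant`). Conversely Z_k ≤ (∫ φ dν)^k δ_k^{k(k-1)} for a majorant φ
(`IsMajorant.normalizationConstant_le`): φ = 1 for finite ν, and the indicator of a disc plus a
multiple of ε^a in the other case. After the k(k-1)-th root the extra factors are M_m^{2/m} and (∫ φ
dν)^{1/m}, both of limsup at most 1. -/

/-! ### Algebra of the squared Vandermonde. -/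

/-- The weighted distance `|z - t| w(z) w(t)`. -/
def pairKernel (Q : ℂ → EReal) (z t : ℂ) : ℝ≥0∞ :=
  edist z t * weight Q z * weight Q t

lemma pairKernel_comm (Q : ℂ → EReal) (z t : ℂ) : pairKernel Q z t = pairKernel Q t z := by
  unfold pairKernel
  rw [edist_comm]
  ring

/-- The square of the weighted Vandermonde, as a product over all ordered pairs. -/
def sqVDM (Q : ℂ → EReal) {k : ℕ} (z : Fin k → ℂ) : ℝ≥0∞ :=
  ∏ i, ∏ j, if i = j then 1 else pairKernel Q (z i) (z j)

lemma absVDM_sq (Q : ℂ → EReal) {k : ℕ} (z : Fin k → ℂ) : absVDM Q z ^ 2 = sqVDM Q z := by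
  have h1 : absVDM Q z = ∏ i, ∏ j, if i < j then pairKernel Q (z i) (z j) else 1 := by
    unfold absVDM pairKernel
    refine Finset.prod_congr rfl fun i _ => ?_
    rw [← Finset.prod_filter]
    refine Finset.prod_congr ?_ fun _ _ => rfl
    ext j; simp
  have h2 : absVDM Q z = ∏ i, ∏ j, if j < i then pairKernel Q (z i) (z j) else 1 := by
    rw [h1, Finset.prod_comm]
    simp_rw [pairKernel_comm Q (z _) (z _)]
  rw [sq]
  nth_rewrite 1 [h1]
  rw [h2, ← Finset.prod_mul_distrib]
  refine Finset.prod_congr rfl fun i _ => ?_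
  rw [← Finset.prod_mul_distrib]
  refine Finset.prod_congr rfl fun j _ => ?_
  rcases lt_trichotomy i j with h | h | h
  · simp [h, h.ne, h.not_gt]
  · simp [h]
  · simp [h, h.ne', h.not_gt]

lemma sqVDM_succAbove (Q : ℂ → EReal) {m : ℕ} (z : Fin (m + 1) → ℂ) (i : Fin (m + 1)) :
    sqVDM Q z = sqVDM Q (fun j => z (i.succAbove j)) *
      (∏ j, pairKernel Q (z i) (z (i.succAbove j))) ^ 2 := by
  unfold sqVDM
  rw [Fin.prod_univ_succAbove _ i, Fin.prod_univ_succAbove _ i]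
  simp_rw [Fin.prod_univ_succAbove _ i]
  simp only [if_true, one_mul, Finset.prod_mul_distrib, Fin.succAbove_ne, (Fin.succAbove_ne _ _).symm,
    if_false, Fin.succAbove_right_inj]
  simp_rw [pairKernel_comm Q (z (i.succAbove _)) (z i)]
  ring

lemma sqVDM_eq_prod (Q : ℂ → EReal) {m : ℕ} (z : Fin (m + 1) → ℂ) :
    sqVDM Q z = ∏ i, ∏ j, pairKernel Q (z i) (z (i.succAbove j)) := by
  unfold sqVDM
  refine Finset.prod_congr rfl fun i _ => ?_
  rw [Fin.prod_univ_succAbove _ i]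
  simp [(Fin.succAbove_ne _ _).symm]

/-- Multiply `sqVDM_succAbove` over all i: the one-point factors together run over all ordered
pairs, and they occur squared. -/
lemma sqVDM_pow_eq (Q : ℂ → EReal) {m : ℕ} (z : Fin (m + 1) → ℂ) :
    sqVDM Q z ^ (m + 1) =
      (∏ i : Fin (m + 1), sqVDM Q (fun j => z (i.succAbove j))) * sqVDM Q z ^ 2 := by
  have h : ∀ i : Fin (m + 1), sqVDM Q z = _ := fun i => sqVDM_succAbove Q z i
  calc sqVDM Q z ^ (m + 1) = ∏ i : Fin (m + 1), sqVDM Q z := by simp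
    _ = ∏ i : Fin (m + 1), (sqVDM Q (fun j => z (i.succAbove j)) *
      (∏ j, pairKernel Q (z i) (z (i.succAbove j))) ^ 2) := Finset.prod_congr rfl fun i _ => h i
    _ = _ := by rw [Finset.prod_mul_distrib, Finset.prod_pow, ← sqVDM_eq_prod]

/-! ### Monotonicity of the weighted diameters. -/

/-- The power in the definition of `weightedDiameter`, in terms of `sqVDM`. -/
lemma absVDM_rpow (Q : ℂ → EReal) {k : ℕ} (z : Fin k → ℂ) :
    absVDM Q z ^ (2 / ((k : ℝ) * ((k : ℝ) - 1))) =
      sqVDM Q z ^ (1 / ((k : ℝ) * ((k : ℝ) - 1))) := by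
  rw [← absVDM_sq, ← ENNReal.rpow_natCast, ← ENNReal.rpow_mul]
  congr 1
  push_cast
  ring

lemma natCast_mul_sub_one (m : ℕ) :
    ((m + 1 : ℕ) : ℝ) * (((m + 1 : ℕ) : ℝ) - 1) = (((m + 1) * m : ℕ) : ℝ) := by
  push_cast
  ring

lemma sqVDM_le (K : Set ℂ) (Q : ℂ → EReal) {m : ℕ} (hm : 1 ≤ m) (z : Fin (m + 1) → ℂ)
    (hz : ∀ i, z i ∈ K) :
    sqVDM Q z ≤ weightedDiameter K Q (m + 1) ^ ((m + 1) * m) := by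
  have h : absVDM Q z ^ (2 / (((m + 1 : ℕ) : ℝ) * (((m + 1 : ℕ) : ℝ) - 1))) ≤
      weightedDiameter K Q (m + 1) :=
    le_iSup₂ (f := fun (z : Fin (m + 1) → ℂ) (_ : ∀ i, z i ∈ K) =>
      absVDM Q z ^ (2 / (((m + 1 : ℕ) : ℝ) * (((m + 1 : ℕ) : ℝ) - 1)))) z hz
  rw [absVDM_rpow, natCast_mul_sub_one, one_div] at h
  rw [← ENNReal.rpow_natCast]
  exact (ENNReal.rpow_inv_le_iff (by positivity)).1 h

lemma weightedDiameter_le (K : Set ℂ) (Q : ℂ → EReal) {m : ℕ} (hm : 1 ≤ m) (c : ℝ≥0∞)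
    (h : ∀ z : Fin (m + 1) → ℂ, (∀ i, z i ∈ K) → sqVDM Q z ≤ c ^ ((m + 1) * m)) :
    weightedDiameter K Q (m + 1) ≤ c := by
  refine iSup₂_le fun z hz => ?_
  rw [absVDM_rpow, natCast_mul_sub_one, one_div]
  refine (ENNReal.rpow_inv_le_iff (by positivity)).2 ?_
  rw [ENNReal.rpow_natCast]
  exact h z hz

/-- Fekete's argument: among the m + 2 configurations left by deleting one point, each pair survives
in exactly m. Finiteness is what permits the cancellation in `[0, ∞]`. -/
lemma weightedDiameter_succ_le (K : Set ℂ) (Q : ℂ → EReal) {m : ℕ} (hm : 1 ≤ m)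
    (hfin : ∀ z : Fin (m + 2) → ℂ, (∀ i, z i ∈ K) → sqVDM Q z ≠ ⊤) :
    weightedDiameter K Q (m + 2) ≤ weightedDiameter K Q (m + 1) := by
  refine weightedDiameter_le K Q (by omega) _ fun z hz => ?_
  rcases eq_or_ne (sqVDM Q z) 0 with h0 | h0
  · simp [h0]
  have hD := sqVDM_pow_eq Q z
  have h1 : sqVDM Q z ^ m = ∏ i : Fin (m + 2), sqVDM Q (fun j => z (i.succAbove j)) := by
    have h2 : sqVDM Q z ^ 2 ≠ 0 := pow_ne_zero _ h0
    have h3 : sqVDM Q z ^ 2 ≠ ⊤ := ENNReal.pow_ne_top (hfin z hz)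
    rw [pow_add _ m 2] at hD
    exact (ENNReal.mul_left_inj h2 h3).1 hD
  have h4 : sqVDM Q z ^ m ≤
      (weightedDiameter K Q (m + 1) ^ ((m + 1 + 1) * (m + 1))) ^ m := by
    rw [h1]
    calc _ ≤ ∏ i : Fin (m + 2), weightedDiameter K Q (m + 1) ^ ((m + 1) * m) :=
          Finset.prod_le_prod' fun i _ => sqVDM_le K Q hm _ fun j => hz _
      _ = _ := by
          rw [Finset.prod_const, Finset.card_univ, Fintype.card_fin, ← pow_mul, ← pow_mul]
          congr 1
          ring
  exact (ENNReal.pow_le_pow_left_iff (by omega)).1 h4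

/-! ### Measurability, and measures of finite energy. -/

open Classical in
/-- The extension of `Q` from `K` to the plane by `+∞`. -/
def extendTop (K : Set ℂ) (Q : ℂ → EReal) (z : ℂ) : EReal :=
  if z ∈ K then Q z else ⊤

lemma extendTop_of_mem {K : Set ℂ} {Q : ℂ → EReal} {z : ℂ} (hz : z ∈ K) :
    extendTop K Q z = Q z := if_pos hz

/-- Extending by `⊤` off a closed set preserves lower semicontinuity; `Q` itself is arbitrary off
`K`. -/
lemma measurable_extendTop {K : Set ℂ} (hK : IsClosed K) {Q : ℂ → EReal}
    (hQ : LowerSemicontinuousOn Q K) : Measurable (extendTop K Q) := by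
  have : LowerSemicontinuous (extendTop K Q) := by
    intro z y hy
    by_cases hz : z ∈ K
    · rw [extendTop_of_mem hz] at hy
      have := eventually_nhdsWithin_iff.1 (hQ z hz y hy)
      filter_upwards [this] with x hx
      by_cases hxK : x ∈ K
      · rw [extendTop_of_mem hxK]; exact hx hxK
      · simp only [extendTop, hxK, if_false]
        exact lt_of_lt_of_le hy le_top
    · filter_upwards [hK.isOpen_compl.mem_nhds hz] with x hx
      have hyt : y < ⊤ := lt_of_lt_of_le hy le_top
      simpa [extendTop, show x ∉ K from hx] using hyt
  exact this.measurable

lemma measurable_logKernel : Measurable (fun p : ℂ × ℂ => (logKernel p.1 p.2).toENNReal) := by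
  unfold logKernel
  exact ((ENNReal.measurable_log.comp (measurable_fst.edist measurable_snd)).neg).ereal_toENNReal

lemma prod_exp_coe {ι : Type*} (s : Finset ι) (f : ι → ℝ≥0∞) :
    ∏ i ∈ s, EReal.exp (f i) = EReal.exp ((∑ i ∈ s, f i : ℝ≥0∞) : EReal) := by
  classical
  induction s using Finset.induction_on with
  | empty => simp
  | insert i s hi ih =>
    rw [Finset.prod_insert hi, Finset.sum_insert hi, ih, EReal.coe_ennreal_add, EReal.exp_add]

/-- On `C` the negative part is at most the positive part of log diam C. Hence finite energy forces
the positive part to be integrable. -/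
lemma lintegral_negPart_logKernel_ne_top {C : Set ℂ} (hC : IsCompact C) {μ : Measure ℂ}
    [IsProbabilityMeasure μ] (hμ : μ Cᶜ = 0) :
    ∫⁻ z, ∫⁻ t, (-logKernel z t).toENNReal ∂μ ∂μ ≠ ⊤ := by
  have hae : ∀ᵐ z ∂μ, z ∈ C := hμ
  have hd : Metric.ediam C ≠ ⊤ := hC.isBounded.ediam_ne_top
  have hb : (ENNReal.log (Metric.ediam C)).toENNReal ≠ ⊤ := by
    rw [Ne, EReal.toENNReal_eq_top_iff, ENNReal.log_eq_top_iff]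
    exact hd
  refine ne_top_of_le_ne_top hb ?_
  calc _ ≤ ∫⁻ z, ∫⁻ t, (ENNReal.log (Metric.ediam C)).toENNReal ∂μ ∂μ := by
        refine lintegral_mono_ae ?_
        filter_upwards [hae] with z hz
        refine lintegral_mono_ae ?_
        filter_upwards [hae] with t ht
        refine EReal.toENNReal_le_toENNReal ?_
        rw [logKernel, neg_neg]
        exact ENNReal.log_le_log (Metric.edist_le_ediam_of_mem hz ht)
    _ = _ := by simp

/-- A nonpolar set of finite weight carries a measure whose potential is bounded on its support. -/
lemma exists_bounded_potential {K : Set ℂ} (hK : IsClosed K) {Q : ℂ → EReal}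
    (hQ : IsWeight K Q) :
    ∃ (n : ℕ) (F : Set ℂ) (μ : Measure ℂ), F ⊆ K ∧ IsCompact F ∧ (∀ z ∈ F, Q z ≤ (n : EReal)) ∧
      μ F ≠ 0 ∧ μ F ≠ ⊤ ∧ ∀ z ∈ F, ∫⁻ t in F, (logKernel z t).toENNReal ∂μ ≤ n := by
  have hnp := hQ.nonpolar
  unfold IsPolar at hnp
  push Not at hnp
  obtain ⟨C, hCK, hC, μ, hμ, hμC, hE⟩ := hnp
  have hP : ∫⁻ z, ∫⁻ t, (logKernel z t).toENNReal ∂μ ∂μ ≠ ⊤ := by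
    intro h
    apply hE
    have hN := lintegral_negPart_logKernel_ne_top hC hμC
    unfold logEnergy
    rw [h]
    lift (∫⁻ z, ∫⁻ t, (-logKernel z t).toENNReal ∂μ ∂μ) to ℝ≥0 using hN with N
    exact EReal.top_sub_coe _
  -- Only the positive part of the kernel enters, so restricting `μ` to a subset can only lower this
  -- potential.
  set U : ℂ → ℝ≥0∞ := fun z => ∫⁻ t, (logKernel z t).toENNReal ∂μ with hU
  have hUm : Measurable U := measurable_logKernel.lintegral_prod_right'
  have hUfin : ∀ᵐ z ∂μ, U z < ⊤ := ae_lt_top hUm hP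
  let S : ℕ → Set ℂ := fun n => C ∩ {z | extendTop K Q z ≤ (n : EReal)} ∩ {z | U z ≤ n}
  have hSm : ∀ n, MeasurableSet (S n) := fun n =>
    (hC.measurableSet.inter (measurable_extendTop hK hQ.lsc measurableSet_Iic)).inter
      (hUm measurableSet_Iic)
  have hex : ∃ n, 0 < μ (S n) := by
    by_contra! h
    have h0 : μ (⋃ n, S n) = 0 := measure_iUnion_null fun n => le_antisymm (h n) bot_le
    have h1 : ∀ᵐ z ∂μ, z ∈ C := hμC
    have h2 : ∀ᵐ z ∂μ, z ∉ ⋃ n, S n := measure_eq_zero_iff_ae_notMem.1 h0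
    have h3 : ∀ᵐ _ ∂μ, False := by
      filter_upwards [h1, h2, hUfin] with z hz hz2 hz3
      apply hz2
      obtain ⟨hzK, hzQ⟩ := hCK hz
      obtain ⟨a, ha⟩ := ENNReal.exists_nat_gt hz3.ne
      obtain ⟨b, hb⟩ : ∃ b : ℕ, Q z ≤ (b : EReal) := by
        have hzb := hQ.ne_bot z hzK
        lift Q z to ℝ using ⟨hzQ.ne, hzb⟩ with q
        obtain ⟨b, hb⟩ := exists_nat_ge q
        exact ⟨b, by exact_mod_cast hb⟩
      refine Set.mem_iUnion.2 ⟨max a b, ⟨hz, ?_⟩, ?_⟩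
      · change extendTop K Q z ≤ _
        rw [extendTop_of_mem hzK]
        refine hb.trans ?_
        exact_mod_cast le_max_right a b
      · change U z ≤ _
        refine ha.le.trans ?_
        exact_mod_cast le_max_left a b
    rw [eventually_false_iff_eq_bot, ae_eq_bot] at h3
    exact IsProbabilityMeasure.ne_zero μ h3
  obtain ⟨n, hn⟩ := hex
  obtain ⟨F, hFS, hF, hFpos⟩ := (hSm n).exists_lt_isCompact hn
  refine ⟨n, F, μ, fun z hz => (hCK (hFS hz).1.1).1, hF, fun z hz => ?_, hFpos.ne',
    measure_ne_top μ F, fun z hz => ?_⟩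
  · have := (hFS hz).1.2
    rwa [Set.mem_ofPred_eq, extendTop_of_mem (hCK (hFS hz).1.1).1] at this
  · exact (setLIntegral_le_lintegral F _).trans (hFS hz).2

lemma one_le_edist_mul_exp {z t : ℂ} (h : (logKernel z t).toENNReal ≠ ⊤) :
    1 ≤ edist z t * EReal.exp ((logKernel z t).toENNReal : EReal) := by
  have h0 : edist z t ≠ 0 := by
    intro h0
    apply h
    simp [logKernel, h0]
  have h1 : (edist z t)⁻¹ ≤ EReal.exp ((logKernel z t).toENNReal : EReal) := by
    calc (edist z t)⁻¹ = EReal.exp (logKernel z t) := by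
          rw [logKernel, EReal.exp_neg, ENNReal.exp_log]
      _ ≤ _ := EReal.exp_monotone (by rw [EReal.coe_toENNReal_eq_max]; exact le_max_right _ _)
  calc 1 = edist z t * (edist z t)⁻¹ := (ENNReal.mul_inv_cancel h0 (edist_ne_top _ _)).symm
    _ ≤ _ := by gcongr

/-- Comparison of the distance to `a` with the distance to a point of `F` nearest to `a`. -/
lemma exists_nearest_bound {F : Set ℂ} (hF : IsCompact F) (hne : F.Nonempty) :
    ∃ A : ℝ≥0∞, A ≠ ⊤ ∧ ∀ a : ℂ, ∃ a' ∈ F, ∀ t ∈ F, (logKernel a' t).toENNReal ≠ ⊤ →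
      1 + ‖a‖ₑ ≤ A * (edist t a * EReal.exp ((logKernel a' t).toENNReal : EReal)) := by
  obtain ⟨ρ, hρ0, hρ⟩ : ∃ ρ : ℝ, 0 ≤ ρ ∧ ∀ t ∈ F, ‖t‖ ≤ ρ := by
    obtain ⟨ρ, hρ⟩ := hF.isBounded.exists_norm_le
    exact ⟨max ρ 0, le_max_right _ _, fun t ht => (hρ t ht).trans (le_max_left _ _)⟩
  -- For |a| ≤ 2ρ + 1, use 1 + |a| ≤ 2(ρ + 1) and |a' - t| ≤ 2|t - a|. For larger |a|, |t - a| ≥ |a|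
  -- - ρ suffices.
  refine ⟨ENNReal.ofReal (4 * (ρ + 1)), ENNReal.ofReal_ne_top, fun a => ?_⟩
  obtain ⟨a', ha', hdist⟩ := hF.exists_infDist_eq_dist hne a
  refine ⟨a', ha', fun t ht hfin => ?_⟩
  have hnear : dist a a' ≤ dist t a := by
    rw [← hdist, dist_comm]
    exact Metric.infDist_le_dist_of_mem ht
  have h1a : 1 + ‖a‖ₑ = ENNReal.ofReal (1 + ‖a‖) := by
    rw [ENNReal.ofReal_add zero_le_one (norm_nonneg a), ofReal_norm, ENNReal.ofReal_one]
  have htri : dist a' t ≤ 2 * dist t a := by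
    have := dist_triangle a' a t
    rw [dist_comm a' a, dist_comm a t] at this
    linarith
  by_cases ha : ‖a‖ ≤ 2 * ρ + 1
  · have h2 := one_le_edist_mul_exp hfin
    calc 1 + ‖a‖ₑ ≤ ENNReal.ofReal (2 * (ρ + 1)) * 1 := by
          rw [h1a, mul_one]
          exact ENNReal.ofReal_le_ofReal (by linarith)
      _ ≤ ENNReal.ofReal (2 * (ρ + 1)) *
            (edist a' t * EReal.exp ((logKernel a' t).toENNReal : EReal)) := by gcongr
      _ ≤ ENNReal.ofReal (2 * (ρ + 1)) * (ENNReal.ofReal (2 * dist t a) *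
            EReal.exp ((logKernel a' t).toENNReal : EReal)) := by
          gcongr
          rw [edist_dist]
          exact ENNReal.ofReal_le_ofReal htri
      _ = _ := by
          rw [edist_dist, ← mul_assoc, ← mul_assoc, ← ENNReal.ofReal_mul (by positivity),
            ← ENNReal.ofReal_mul (by positivity)]
          congr 2
          ring
  · push Not at ha
    have h3 : ‖a‖ - ρ ≤ dist t a := by
      have := norm_sub_norm_le a t
      rw [dist_comm, dist_eq_norm]
      linarith [hρ t ht]
    calc 1 + ‖a‖ₑ ≤ ENNReal.ofReal (4 * (ρ + 1) * dist t a) * 1 := by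
          rw [h1a, mul_one]
          refine ENNReal.ofReal_le_ofReal ?_
          have : 0 ≤ ρ * dist t a := by positivity
          nlinarith
      _ ≤ ENNReal.ofReal (4 * (ρ + 1) * dist t a) *
            EReal.exp ((logKernel a' t).toENNReal : EReal) := by
          gcongr
          rw [EReal.one_le_exp_iff]
          exact EReal.coe_ennreal_nonneg _
      _ = _ := by
          rw [edist_dist, ENNReal.ofReal_mul (by positivity), mul_assoc]

/-- Products of linear factors are large at some point of a suitable compact subset of `K`. -/
lemma exists_prod_edist_ge {K : Set ℂ} (hK : IsClosed K) {Q : ℂ → EReal}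
    (hQ : IsWeight K Q) :
    ∃ (n : ℕ) (c : ℝ≥0∞), c ≠ ⊤ ∧ ∀ (m : ℕ) (a : Fin m → ℂ), ∃ t ∈ K, Q t ≤ (n : EReal) ∧
      ∏ i, (1 + ‖a i‖ₑ) ≤ c ^ m * ∏ i, edist t (a i) := by
  obtain ⟨n, F, μ, hFK, hF, hFQ, hF0, hFt, hpot⟩ := exists_bounded_potential hK hQ
  obtain ⟨A, hA, hnear⟩ := exists_nearest_bound hF (nonempty_of_measure_ne_zero hF0)
  have hb : (n : ℝ≥0∞) / μ F ≠ ⊤ := ENNReal.div_ne_top (ENNReal.natCast_ne_top n) hF0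
  set b : ℝ≥0∞ := n / μ F with hbdef
  have hexp : EReal.exp (b : EReal) ≠ ⊤ := by
    rw [Ne, EReal.exp_eq_top_iff, EReal.coe_ennreal_eq_top_iff]
    exact hb
  use n, A * EReal.exp (b : EReal), ENNReal.mul_ne_top hA hexp
  intro m a
  choose a' ha'F ha' using hnear
  set G : ℂ → ℝ≥0∞ := fun t => ∑ i, (logKernel (a' (a i)) t).toENNReal with hG
  have hm : ∀ z, Measurable fun t => (logKernel z t).toENNReal := fun z =>
    (measurable_logKernel.comp (measurable_prodMk_left (x := z)) :)
  have hGm : Measurable G := Finset.measurable_fun_sum _ fun i _ => hm _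
  -- First moment method: the sum of the m potentials has average at most m b over `F`, so one `t`
  -- serves all the `a i` together.
  obtain ⟨t, htF, ht⟩ := exists_le_setLAverage hF0 hFt hGm.aemeasurable
  have hGt : G t ≤ m * b := by
    apply le_trans ht
    rw [setLAverage_eq, hbdef, ← mul_div_assoc]
    gcongr
    rw [hG, lintegral_finsetSum _ fun i _ => hm _]
    calc _ ≤ ∑ i : Fin m, (n : ℝ≥0∞) := Finset.sum_le_sum fun i _ => hpot _ (ha'F _)
      _ = _ := by simp
  have hfin : ∀ i, (logKernel (a' (a i)) t).toENNReal ≠ ⊤ := by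
    intro i
    have hmb : (m : ℝ≥0∞) * b ≠ ⊤ := ENNReal.mul_ne_top (ENNReal.natCast_ne_top m) hb
    apply ne_top_of_le_ne_top hmb
    apply le_trans _ hGt
    exact Finset.single_le_sum (f := fun i => (logKernel (a' (a i)) t).toENNReal)
      (fun _ _ => zero_le) (Finset.mem_univ i)
  suffices h : ∏ i, (1 + ‖a i‖ₑ) ≤ (A * EReal.exp (b : EReal)) ^ m * ∏ i, edist t (a i) from
    ⟨t, hFK htF, hFQ t htF, h⟩
  calc ∏ i, (1 + ‖a i‖ₑ) ≤ ∏ i, (A * (edist t (a i) *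
        EReal.exp ((logKernel (a' (a i)) t).toENNReal : EReal))) :=
        Finset.prod_le_prod' fun i _ => ha' (a i) t htF (hfin i)
    _ = A ^ m * ((∏ i, edist t (a i)) * EReal.exp (G t : EReal)) := by
        rw [Finset.prod_mul_distrib, Finset.prod_mul_distrib, prod_exp_coe]
        simp [hG]
    _ ≤ A ^ m * ((∏ i, edist t (a i)) * EReal.exp (b : EReal) ^ m) := by
        gcongr
        rw [← EReal.exp_nmul, EReal.exp_le_exp_iff]
        have := EReal.coe_ennreal_le_coe_ennreal_iff.2 hGt
        rw [EReal.coe_ennreal_mul] at this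
        convert! this using 2
    _ = _ := by rw [mul_pow]; ring

/-! ### Finiteness, and dependence on a single point. -/

lemma weight_ne_top {K : Set ℂ} {Q : ℂ → EReal} (hQ : IsWeight K Q) {z : ℂ} (hz : z ∈ K) :
    weight Q z ≠ ⊤ := by
  rw [weight, Ne, EReal.exp_eq_top_iff, EReal.neg_eq_top_iff]
  exact hQ.ne_bot z hz

lemma pairKernel_ne_top {K : Set ℂ} {Q : ℂ → EReal} (hQ : IsWeight K Q) {z t : ℂ} (hz : z ∈ K)
    (ht : t ∈ K) : pairKernel Q z t ≠ ⊤ :=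
  ENNReal.mul_ne_top (ENNReal.mul_ne_top (edist_ne_top _ _) (weight_ne_top hQ hz))
    (weight_ne_top hQ ht)

lemma sqVDM_ne_top {K : Set ℂ} {Q : ℂ → EReal} (hQ : IsWeight K Q) {k : ℕ} {z : Fin k → ℂ}
    (hz : ∀ i, z i ∈ K) : sqVDM Q z ≠ ⊤ := by
  refine ENNReal.prod_ne_top fun i _ => ENNReal.prod_ne_top fun j _ => ?_
  split_ifs
  · exact ENNReal.one_ne_top
  · exact pairKernel_ne_top hQ (hz i) (hz j)

lemma prod_pairKernel (Q : ℂ → EReal) {m : ℕ} (x : ℂ) (z : Fin m → ℂ) :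
    ∏ j, pairKernel Q x (z j) =
      (weight Q x ^ m * ∏ j, edist x (z j)) * ∏ j, weight Q (z j) := by
  unfold pairKernel
  simp only [Finset.prod_mul_distrib, Finset.prod_const, Finset.card_univ, Fintype.card_fin]
  ring

/-- The part of `sqVDM` that does not depend on the `i`-th point. -/
def coVDM (Q : ℂ → EReal) {m : ℕ} (z : Fin (m + 1) → ℂ) (i : Fin (m + 1)) : ℝ≥0∞ :=
  sqVDM Q (fun j => z (i.succAbove j)) * (∏ j, weight Q (z (i.succAbove j))) ^ 2

lemma sqVDM_update (Q : ℂ → EReal) {m : ℕ} (z : Fin (m + 1) → ℂ) (i : Fin (m + 1)) (x : ℂ) :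
    sqVDM Q (Function.update z i x) =
      coVDM Q z i * (weight Q x ^ m * ∏ j, edist x (z (i.succAbove j))) ^ 2 := by
  rw [sqVDM_succAbove Q _ i, coVDM]
  simp only [Function.update_self, ne_eq, Fin.succAbove_ne, not_false_eq_true,
    Function.update_of_ne, prod_pairKernel]
  ring

lemma coVDM_ne_top {K : Set ℂ} {Q : ℂ → EReal} (hQ : IsWeight K Q) {m : ℕ}
    {z : Fin (m + 1) → ℂ} (hz : ∀ i, z i ∈ K) (i : Fin (m + 1)) : coVDM Q z i ≠ ⊤ :=
  ENNReal.mul_ne_top (sqVDM_ne_top hQ fun _ => hz _)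
    (ENNReal.pow_ne_top (ENNReal.prod_ne_top fun _ _ => weight_ne_top hQ (hz _)))

/-! ### Growth at infinity and upper bounds. -/

lemma eventually_atInfinity {K : Set ℂ} {p : ℂ → Prop} (h : ∀ᶠ z in atInfinity K, p z) :
    ∃ R : ℝ, ∀ z ∈ K, R ≤ ‖z‖ → p z := by
  rw [atInfinity, eventually_inf_principal] at h
  obtain ⟨R, -, hR⟩ := (Filter.hasBasis_cobounded_norm (E := ℂ)).eventually_iff.1 h
  exact ⟨R, fun z hz hzR => hR hzR hz⟩

lemma weight_mul_enorm (Q : ℂ → EReal) {z : ℂ} (hz : z ≠ 0) :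
    weight Q z * ‖z‖ₑ = EReal.exp (-(Q z - ((Real.log ‖z‖ : ℝ) : EReal))) := by
  have h : ‖z‖ₑ = EReal.exp ((Real.log ‖z‖ : ℝ) : EReal) := by
    rw [EReal.exp_coe, Real.exp_log (norm_pos_iff.2 hz), ofReal_norm]
  rw [weight, h, ← EReal.exp_add, EReal.neg_sub (Or.inr (EReal.coe_ne_bot _))
    (Or.inr (EReal.coe_ne_top _))]

lemma WeaklyAdmissible.exists_weight_le {K : Set ℂ} {Q : ℂ → EReal} (h : WeaklyAdmissible K Q) :
    ∃ (C : ℝ≥0∞) (R : ℝ), C ≠ ⊤ ∧ ∀ z ∈ K, R ≤ ‖z‖ → weight Q z * ‖z‖ₑ ≤ C := by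
  obtain ⟨b, hb1, hb2⟩ := exists_between h.2
  obtain ⟨R, hR⟩ := eventually_atInfinity (eventually_lt_of_lt_liminf hb2)
  refine ⟨EReal.exp (-b), max R 1, ?_, fun z hz hzR => ?_⟩
  · rw [Ne, EReal.exp_eq_top_iff, EReal.neg_eq_top_iff]
    exact hb1.ne'
  · have h0 : z ≠ 0 := norm_pos_iff.1 (zero_lt_one.trans_le ((le_max_right _ _).trans hzR))
    rw [weight_mul_enorm Q h0, EReal.exp_le_exp_iff, EReal.neg_le_neg_iff]
    exact (hR z hz ((le_max_left _ _).trans hzR)).le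

lemma ControlsAtInfinity.exists_weight_le {K : Set ℂ} {ν : Measure ℂ} {Q : ℂ → EReal}
    {ε : ℂ → ℝ≥0} (h : ControlsAtInfinity K ν Q ε) :
    ∃ R : ℝ, ∀ z ∈ K, R ≤ ‖z‖ → weight Q z * ‖z‖ₑ ≤ ε z := by
  obtain ⟨R, hR⟩ := eventually_atInfinity h.growth
  refine ⟨max R 1, fun z hz hzR => ?_⟩
  have h0 : z ≠ 0 := norm_pos_iff.1 (zero_lt_one.trans_le ((le_max_right _ _).trans hzR))
  rw [weight_mul_enorm Q h0]
  have := EReal.neg_le_of_neg_le (hR z hz ((le_max_left _ _).trans hzR))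
  calc _ ≤ EReal.exp (ENNReal.log (ε z : ℝ≥0∞)) := EReal.exp_monotone this
    _ = _ := ENNReal.exp_log _

lemma one_add_enorm_le {z : ℂ} (h : 1 ≤ ‖z‖) : 1 + ‖z‖ₑ ≤ 2 * ‖z‖ₑ := by
  have : 1 ≤ ‖z‖ₑ := by rwa [← ofReal_norm, ENNReal.one_le_ofReal]
  rw [two_mul]
  gcongr

/-- Near infinity this is the hypothesis; on the remaining compact part `Q` attains its minimum by
lower semicontinuity. -/
lemma exists_weight_bound {K : Set ℂ} (hK : IsClosed K) {Q : ℂ → EReal} (hQ : IsWeight K Q)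
    (h : ∃ (C : ℝ≥0∞) (R : ℝ), C ≠ ⊤ ∧ ∀ z ∈ K, R ≤ ‖z‖ → weight Q z * ‖z‖ₑ ≤ C) :
    ∃ C : ℝ≥0∞, C ≠ ⊤ ∧ ∀ z ∈ K, weight Q z * (1 + ‖z‖ₑ) ≤ C := by
  obtain ⟨C, R, hC, hCR⟩ := h
  obtain ⟨D, hD, hDw⟩ : ∃ D : ℝ≥0∞, D ≠ ⊤ ∧
      ∀ z ∈ K ∩ Metric.closedBall 0 (max R 1), weight Q z ≤ D := by
    rcases (K ∩ Metric.closedBall 0 (max R 1)).eq_empty_or_nonempty with he | hne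
    · exact ⟨0, ENNReal.zero_ne_top, by simp [he]⟩
    · obtain ⟨q, hq, hmin⟩ := LowerSemicontinuousOn.exists_isMinOn hne
        ((isCompact_closedBall (0 : ℂ) (max R 1)).inter_left hK)
        (hQ.lsc.mono Set.inter_subset_left)
      exact ⟨weight Q q, weight_ne_top hQ hq.1, fun z hz =>
        EReal.exp_monotone (EReal.neg_le_neg_iff.2 (hmin hz))⟩
  refine ⟨max (D * (1 + ENNReal.ofReal (max R 1))) (2 * C), ?_, fun z hz => ?_⟩
  · exact max_ne_top (ENNReal.mul_ne_top hD (by simp)) (ENNReal.mul_ne_top (by simp) hC)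
  rcases le_total ‖z‖ (max R 1) with hzR | hzR
  · refine le_trans ?_ (le_max_left _ _)
    gcongr
    · exact hDw z ⟨hz, by simpa using hzR⟩
    · rw [← ofReal_norm]
      exact ENNReal.ofReal_le_ofReal hzR
  · refine le_trans ?_ (le_max_right _ _)
    calc _ ≤ weight Q z * (2 * ‖z‖ₑ) := by
          gcongr
          exact one_add_enorm_le ((le_max_right _ _).trans hzR)
      _ = 2 * (weight Q z * ‖z‖ₑ) := by ring
      _ ≤ _ := by
          gcongr
          exact hCR z hz ((le_max_left _ _).trans hzR)

lemma edist_le_mul (z t : ℂ) : edist z t ≤ (1 + ‖z‖ₑ) * (1 + ‖t‖ₑ) := by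
  calc edist z t = ‖z - t‖ₑ := edist_eq_enorm_sub z t
    _ ≤ ‖z‖ₑ + ‖t‖ₑ := enorm_sub_le
    _ ≤ (‖z‖ₑ + ‖t‖ₑ) + (1 + ‖z‖ₑ * ‖t‖ₑ) := le_self_add
    _ = _ := by ring

lemma pairKernel_le {K : Set ℂ} {Q : ℂ → EReal} {C : ℝ≥0∞}
    (hC : ∀ z ∈ K, weight Q z * (1 + ‖z‖ₑ) ≤ C) {z t : ℂ} (hz : z ∈ K) (ht : t ∈ K) :
    pairKernel Q z t ≤ C ^ 2 := by
  calc pairKernel Q z t ≤ ((1 + ‖z‖ₑ) * (1 + ‖t‖ₑ)) * weight Q z * weight Q t := by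
        unfold pairKernel
        gcongr
        exact edist_le_mul z t
    _ = (weight Q z * (1 + ‖z‖ₑ)) * (weight Q t * (1 + ‖t‖ₑ)) := by ring
    _ ≤ C * C := mul_le_mul' (hC z hz) (hC t ht)
    _ = C ^ 2 := (sq C).symm

lemma weightedDiameter_le_sq {K : Set ℂ} {Q : ℂ → EReal} {C : ℝ≥0∞}
    (hC : ∀ z ∈ K, weight Q z * (1 + ‖z‖ₑ) ≤ C) {m : ℕ} (hm : 1 ≤ m) :
    weightedDiameter K Q (m + 1) ≤ C ^ 2 := by
  refine weightedDiameter_le K Q hm _ fun z hz => ?_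
  rw [sqVDM_eq_prod]
  calc _ ≤ ∏ i : Fin (m + 1), ∏ j : Fin m, C ^ 2 :=
        Finset.prod_le_prod' fun i _ => Finset.prod_le_prod' fun j _ =>
          pairKernel_le hC (hz _) (hz _)
    _ = _ := by
        simp only [Finset.prod_const, Finset.card_univ, Fintype.card_fin, ← pow_mul]
        congr 1
        ring

/-! ### Bernstein–Walsh inequality and positivity. -/

lemma exp_neg_le_weight {Q : ℂ → EReal} {t : ℂ} {n : ℕ} (h : Q t ≤ (n : EReal)) :
    1 ≤ EReal.exp (n : EReal) * weight Q t := by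
  have h1 : (EReal.exp (n : EReal))⁻¹ ≤ weight Q t := by
    rw [← EReal.exp_neg]
    exact EReal.exp_monotone (EReal.neg_le_neg_iff.2 h)
  have h0 : EReal.exp (n : EReal) ≠ 0 := by
    rw [Ne, EReal.exp_eq_zero_iff]; exact EReal.natCast_ne_bot n
  have h2 : EReal.exp (n : EReal) ≠ ⊤ := by
    rw [Ne, EReal.exp_eq_top_iff]; exact EReal.natCast_ne_top n
  calc 1 = EReal.exp (n : EReal) * (EReal.exp (n : EReal))⁻¹ := (ENNReal.mul_inv_cancel h0 h2).symm
    _ ≤ _ := by gcongr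

/-- A weighted Bernstein–Walsh inequality for products of linear factors. -/
lemma exists_bernsteinWalsh {K : Set ℂ} (hK : IsClosed K) {Q : ℂ → EReal} (hQ : IsWeight K Q) :
    ∃ (c : ℝ≥0∞), c ≠ ⊤ ∧ ∀ (m : ℕ) (a : Fin m → ℂ), ∃ t ∈ K, 1 ≤ c * weight Q t ∧
      ∏ i, (1 + ‖a i‖ₑ) ≤ c ^ m * (weight Q t ^ m * ∏ i, edist t (a i)) := by
  obtain ⟨n, c, hc, h⟩ := exists_prod_edist_ge hK hQ
  have hn : EReal.exp (n : EReal) ≠ ⊤ := by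
    rw [Ne, EReal.exp_eq_top_iff]; exact EReal.natCast_ne_top n
  -- The factor e^n absorbs the weight at `t`; adding 1 to `c` lets the same constant give the bound
  -- on `weight Q t`.
  refine ⟨(c + 1) * EReal.exp (n : EReal),
    ENNReal.mul_ne_top (ENNReal.add_ne_top.2 ⟨hc, ENNReal.one_ne_top⟩) hn, fun m a => ?_⟩
  obtain ⟨t, ht, htQ, hta⟩ := h m a
  have h1 := exp_neg_le_weight htQ
  refine ⟨t, ht, ?_, hta.trans ?_⟩
  · calc 1 ≤ 1 * (EReal.exp (n : EReal) * weight Q t) := by rwa [one_mul]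
      _ ≤ (c + 1) * (EReal.exp (n : EReal) * weight Q t) := by gcongr; exact le_add_self
      _ = _ := by ring
  · calc c ^ m * ∏ i, edist t (a i) ≤ (c + 1) ^ m * ((1 : ℝ≥0∞) ^ m * ∏ i, edist t (a i)) := by
          rw [one_pow, one_mul]
          gcongr
          exact le_self_add
      _ ≤ (c + 1) ^ m * ((EReal.exp (n : EReal) * weight Q t) ^ m * ∏ i, edist t (a i)) := by
          gcongr
      _ = _ := by simp only [mul_pow]; ring

/-- Greedy choice: each new point comes from `exists_bernsteinWalsh` applied to the previous ones.
The bound 1 ≤ c w at every chosen point is carried along, since the weights of the old points also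
enter. -/
lemma exists_weightedDiameter_ge {K : Set ℂ} (hK : IsClosed K) {Q : ℂ → EReal}
    (hQ : IsWeight K Q) :
    ∃ c : ℝ≥0∞, 0 < c ∧ ∀ m : ℕ, 1 ≤ m → c ≤ weightedDiameter K Q (m + 1) := by
  obtain ⟨c, hc, h⟩ := exists_bernsteinWalsh hK hQ
  have key : ∀ k : ℕ, ∃ z : Fin k → ℂ, (∀ i, z i ∈ K ∧ 1 ≤ c * weight Q (z i)) ∧
      1 ≤ (c ^ 2) ^ (k * (k - 1)) * sqVDM Q z := by
    intro k
    induction k with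
    | zero => exact ⟨Fin.elim0, fun i => i.elim0, by simp [sqVDM]⟩
    | succ k ih =>
      obtain ⟨z, hz, hD⟩ := ih
      obtain ⟨t, htK, htw, ht⟩ := h k z
      refine ⟨Fin.cons t z, ?_, ?_⟩
      · intro i
        refine Fin.cases ⟨htK, htw⟩ (fun j => ?_) i
        simpa using hz j
      have h1 : 1 ≤ (c ^ 2) ^ k * ∏ j, pairKernel Q t (z j) := by
        rw [prod_pairKernel]
        calc 1 ≤ (∏ i, (1 + ‖z i‖ₑ)) * ∏ i, (c * weight Q (z i)) := by
              refine one_le_mul (Finset.one_le_prod' fun i _ => le_self_add)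
                (Finset.one_le_prod' fun i _ => (hz i).2)
          _ ≤ (c ^ k * (weight Q t ^ k * ∏ i, edist t (z i))) * ∏ i, (c * weight Q (z i)) := by
              gcongr
          _ = _ := by
              simp only [Finset.prod_mul_distrib, Finset.prod_const, Finset.card_univ,
                Fintype.card_fin]
              ring
      rw [sqVDM_succAbove Q _ 0]
      simp only [Fin.zero_succAbove, Fin.cons_zero, Fin.cons_succ]
      calc 1 ≤ ((c ^ 2) ^ (k * (k - 1)) * sqVDM Q z) *
            ((c ^ 2) ^ k * ∏ j, pairKernel Q t (z j)) ^ 2 :=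
            one_le_mul hD (one_le_pow_of_one_le' h1 2)
        _ = _ := by
            have : (k + 1) * (k + 1 - 1) = k * (k - 1) + k * 2 := by
              cases k with
              | zero => rfl
              | succ k => simp only [Nat.add_sub_cancel]; ring
            rw [this]
            ring
  refine ⟨(c ^ 2)⁻¹, ENNReal.inv_pos.2 (ENNReal.pow_ne_top hc), fun m hm => ?_⟩
  obtain ⟨z, hz, hD⟩ := key (m + 1)
  have h2 := hD.trans (mul_le_mul_right (sqVDM_le K Q hm z fun i => (hz i).1) _)
  rw [Nat.add_sub_cancel, ← mul_pow] at h2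
  have h3 : 1 ≤ c ^ 2 * weightedDiameter K Q (m + 1) := by
    by_contra! hlt
    exact absurd h2 (not_le.2 (pow_lt_one₀ zero_le hlt (by positivity)))
  have hc0 : c ^ 2 ≠ 0 := by
    intro h0
    simp [h0] at h3
  calc (c ^ 2)⁻¹ = (c ^ 2)⁻¹ * 1 := (mul_one _).symm
    _ ≤ (c ^ 2)⁻¹ * (c ^ 2 * weightedDiameter K Q (m + 1)) := by gcongr
    _ = weightedDiameter K Q (m + 1) := by
        rw [← mul_assoc, ENNReal.inv_mul_cancel hc0 (ENNReal.pow_ne_top hc), one_mul]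

/-! ### Integrable majorants. -/

/-- `φ` dominates the squared modulus of weighted polynomials of large degree, relative to their
values on `K`. -/
def IsMajorant (K : Set ℂ) (Q : ℂ → EReal) (φ : ℂ → ℝ≥0∞) (m₀ : ℕ) : Prop :=
  ∀ m, m₀ ≤ m → ∀ z : Fin m → ℂ, ∀ x ∈ K, ∃ t ∈ K,
    (weight Q x ^ m * ∏ i, edist x (z i)) ^ 2 ≤
      φ x * (weight Q t ^ m * ∏ i, edist t (z i)) ^ 2

lemma isMajorant_one (K : Set ℂ) (Q : ℂ → EReal) : IsMajorant K Q (fun _ => 1) 0 :=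
  fun _ _ _ x hx => ⟨x, hx, by rw [one_mul]⟩

lemma ControlsAtInfinity.exists_isMajorant {K : Set ℂ} (hK : IsClosed K) {ν : Measure ℂ}
    [IsLocallyFiniteMeasure ν] (hν : ν Kᶜ = 0) {Q : ℂ → EReal} (hQ : IsWeight K Q)
    {ε : ℂ → ℝ≥0} (h : ControlsAtInfinity K ν Q ε) :
    ∃ (φ : ℂ → ℝ≥0∞) (m₀ : ℕ), Measurable φ ∧ ∫⁻ z, φ z ∂ν < ⊤ ∧ IsMajorant K Q φ m₀ := by
  classical
  obtain ⟨a, ha, hint⟩ := h.integral_lt_top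
  obtain ⟨c, hc, hBW⟩ := exists_bernsteinWalsh hK hQ
  obtain ⟨R₁, hR₁⟩ := h.exists_weight_le
  -- The 2 comes from |x - z_i| ≤ 2|x|(1 + |z_i|) for |x| ≥ 1, the `c` from Bernstein–Walsh.
  set C : ℝ≥0∞ := 2 * c with hCdef
  have hC : C ≠ ⊤ := ENNReal.mul_ne_top (by simp) hc
  obtain ⟨R₂, hR₂⟩ : ∃ R : ℝ, ∀ z ∈ K, R ≤ ‖z‖ → C * (ε z : ℝ≥0∞) ≤ 1 := by
    have h0 : Tendsto (fun z => C * (ε z : ℝ≥0∞)) (atInfinity K) (𝓝 0) := by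
      have := ENNReal.Tendsto.const_mul (a := C)
        ((ENNReal.tendsto_coe (a := 0)).2 h.tendsto_zero) (Or.inr hC)
      simpa using this
    exact eventually_atInfinity ((h0.eventually (gt_mem_nhds zero_lt_one)).mono fun _ hz => hz.le)
  set R := max 1 (max R₁ R₂)
  have hεm : Measurable (K.piecewise ε 0) :=
    h.continuousOn.measurable_piecewise continuousOn_const hK.measurableSet
  set ψ : ℂ → ℝ≥0∞ := fun z => (C * (K.piecewise ε 0 z : ℝ≥0∞)) ^ a with hψ
  have hψm : Measurable ψ := ((hεm.coe_nnreal_ennreal).const_mul C).pow_const a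
  have hψint : ∫⁻ z, ψ z ∂ν < ⊤ := by
    have hr : ν.restrict K = ν := Measure.restrict_eq_self_of_ae_mem hν
    have : ∀ z ∈ K, ψ z = C ^ a * (ε z : ℝ≥0∞) ^ a := fun z hz => by
      rw [hψ]
      simp only [Set.piecewise_eq_of_mem _ _ _ hz]
      exact ENNReal.mul_rpow_of_nonneg _ _ ha.le
    rw [← hr, setLIntegral_congr_fun hK.measurableSet this,
      lintegral_const_mul' _ _ (ENNReal.rpow_ne_top_of_nonneg ha.le hC)]
    exact ENNReal.mul_lt_top (ENNReal.rpow_lt_top_of_nonneg ha.le hC) hint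
  -- Where C ε ≤ 1, its power 2m is at most its power a once m ≥ a.
  obtain ⟨m₀, hm₀⟩ := exists_nat_ge a
  refine ⟨fun z => (Metric.closedBall 0 R).indicator (fun _ => 1) z + ψ z, m₀,
    (measurable_const.indicator measurableSet_closedBall).add hψm, ?_, fun m hm z x hx => ?_⟩
  · rw [lintegral_add_right _ hψm]
    refine ENNReal.add_lt_top.2 ⟨?_, hψint⟩
    rw [lintegral_indicator measurableSet_closedBall]
    simpa using (isCompact_closedBall (0 : ℂ) R).measure_lt_top
  rcases le_total ‖x‖ R with hxR | hxR
  · refine ⟨x, hx, ?_⟩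
    have : x ∈ Metric.closedBall (0 : ℂ) R := by simpa using hxR
    simp only [Set.indicator_of_mem this]
    exact le_mul_of_one_le_left zero_le le_self_add
  obtain ⟨t, ht, -, hta⟩ := hBW m z
  refine ⟨t, ht, ?_⟩
  have h1 : 1 ≤ ‖x‖ := (le_max_left _ _).trans hxR
  have hε : weight Q x * ‖x‖ₑ ≤ ε x :=
    hR₁ x hx (((le_max_left _ _).trans (le_max_right _ _)).trans hxR)
  have hCε : C * (ε x : ℝ≥0∞) ≤ 1 :=
    hR₂ x hx (((le_max_right _ _).trans (le_max_right _ _)).trans hxR)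
  have hψx : (C * (ε x : ℝ≥0∞)) ^ (2 * m) ≤ ψ x := by
    rw [hψ]
    simp only [Set.piecewise_eq_of_mem _ _ _ hx]
    rw [← ENNReal.rpow_natCast]
    refine ENNReal.rpow_le_rpow_of_exponent_ge hCε (hm₀.trans ?_)
    exact_mod_cast (by omega : m₀ ≤ 2 * m)
  calc (weight Q x ^ m * ∏ i, edist x (z i)) ^ 2
      ≤ (weight Q x ^ m * ((2 * ‖x‖ₑ) ^ m * ∏ i, (1 + ‖z i‖ₑ))) ^ 2 := by
        gcongr
        calc ∏ i, edist x (z i) ≤ ∏ i, (2 * ‖x‖ₑ) * (1 + ‖z i‖ₑ) :=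
              Finset.prod_le_prod' fun i _ => (edist_le_mul _ _).trans
                (mul_le_mul_left (one_add_enorm_le h1) _)
          _ = _ := by simp [Finset.prod_mul_distrib]
    _ ≤ (weight Q x ^ m * ((2 * ‖x‖ₑ) ^ m *
          (c ^ m * (weight Q t ^ m * ∏ i, edist t (z i))))) ^ 2 := by gcongr
    _ = (C * (weight Q x * ‖x‖ₑ)) ^ (2 * m) * (weight Q t ^ m * ∏ i, edist t (z i)) ^ 2 := by
        simp only [hCdef, mul_pow, ← pow_mul]
        ring
    _ ≤ (C * (ε x : ℝ≥0∞)) ^ (2 * m) * (weight Q t ^ m * ∏ i, edist t (z i)) ^ 2 := by gcongr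
    _ ≤ _ := by
        gcongr
        exact hψx.trans le_add_self

/-- Exchange the points indexed by `s` one at a time for the points of `K` supplied by the majorant
property. Each exchange costs one factor `φ (z i)`, and the final configuration is bounded by the
diameter. -/
lemma IsMajorant.sqVDM_le_prod {K : Set ℂ} {Q : ℂ → EReal} {φ : ℂ → ℝ≥0∞} {m₀ : ℕ}
    (h : IsMajorant K Q φ m₀) {m : ℕ} (hm : m₀ ≤ m) (hm1 : 1 ≤ m) (s : Finset (Fin (m + 1))) :
    ∀ z : Fin (m + 1) → ℂ, (∀ i, z i ∈ K) →
      sqVDM Q z ≤ (∏ i ∈ s, φ (z i)) * weightedDiameter K Q (m + 1) ^ ((m + 1) * m) := by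
  induction s using Finset.induction_on with
  | empty =>
    intro z hz
    simpa using sqVDM_le K Q hm1 z hz
  | insert i s hi ih =>
    intro z hz
    obtain ⟨t, ht, hle⟩ := h m hm (fun j => z (i.succAbove j)) (z i) (hz i)
    have hz' : ∀ j, Function.update z i t j ∈ K := fun j => by
      rcases eq_or_ne j i with rfl | hj
      · simpa using ht
      · simpa [hj] using hz j
    have hs : ∏ j ∈ s, φ (Function.update z i t j) = ∏ j ∈ s, φ (z j) :=
      Finset.prod_congr rfl fun j hj => by
        rw [Function.update_of_ne (ne_of_mem_of_not_mem hj hi)]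
    have hupd := sqVDM_update Q z i (z i)
    rw [Function.update_eq_self] at hupd
    calc sqVDM Q z = _ := hupd
      _ ≤ coVDM Q z i * (φ (z i) * (weight Q t ^ m * ∏ j, edist t (z (i.succAbove j))) ^ 2) := by
          gcongr
      _ = φ (z i) * sqVDM Q (Function.update z i t) := by rw [sqVDM_update]; ring
      _ ≤ φ (z i) * ((∏ j ∈ s, φ (z j)) * weightedDiameter K Q (m + 1) ^ ((m + 1) * m)) := by
          gcongr
          rw [← hs]
          exact ih _ hz'
      _ = _ := by rw [Finset.prod_insert hi, mul_assoc]

/-! ### Upper and lower bounds for the normalization constants. -/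

lemma lintegral_pi_prod (ν : Measure ℂ) [SigmaFinite ν] {φ : ℂ → ℝ≥0∞} (hφ : Measurable φ)
    (k : ℕ) :
    ∫⁻ z : Fin k → ℂ, ∏ i, φ (z i) ∂(Measure.pi fun _ => ν) = (∫⁻ z, φ z ∂ν) ^ k := by
  induction k with
  | zero => simp
  | succ k ih =>
    calc _ = ∫⁻ x : ℂ × (Fin k → ℂ), φ x.1 * ∏ i : Fin k, φ (x.2 i)
            ∂(ν.prod (Measure.pi fun _ => ν)) := by
          rw [← (measurePreserving_piFinSuccAbove (fun _ : Fin (k + 1) => ν) 0).lintegral_comp_emb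
            (MeasurableEquiv.measurableEmbedding _)]
          refine lintegral_congr fun x => ?_
          rw [Fin.prod_univ_succ]
          rfl
      _ = _ := by
          rw [lintegral_prod_mul (g := fun y : Fin k → ℂ => ∏ i, φ (y i)) hφ.aemeasurable
            (Finset.measurable_fun_prod _ fun i _ => hφ.comp (measurable_pi_apply i)).aemeasurable,
            ih, pow_succ']

lemma ae_pi_mem {K : Set ℂ} {ν : Measure ℂ} [SigmaFinite ν] (hν : ν Kᶜ = 0) (k : ℕ) :
    ∀ᵐ z ∂(Measure.pi fun _ : Fin k => ν), z ∈ {z : Fin k → ℂ | ∀ i, z i ∈ K} :=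
  ae_all_iff.2 fun i => (Measure.quasiMeasurePreserving_eval (μ := fun _ : Fin k => ν) i).ae
    (p := fun x => x ∈ K) hν

lemma normalizationConstant_eq (K : Set ℂ) (ν : Measure ℂ) [SigmaFinite ν] (hν : ν Kᶜ = 0)
    (Q : ℂ → EReal) (k : ℕ) :
    normalizationConstant K ν Q k =
      ∫⁻ z : Fin k → ℂ, sqVDM (extendTop K Q) z ∂(Measure.pi fun _ => ν) := by
  have hae := ae_pi_mem hν k
  unfold normalizationConstant
  rw [Measure.restrict_eq_self_of_ae_mem hae]
  refine lintegral_congr_ae ?_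
  filter_upwards [hae] with z hz
  rw [absVDM_sq]
  simp only [sqVDM, pairKernel, weight, extendTop_of_mem (hz _)]

lemma IsMajorant.normalizationConstant_le {K : Set ℂ} {Q : ℂ → EReal} {φ : ℂ → ℝ≥0∞} {m₀ : ℕ}
    (h : IsMajorant K Q φ m₀) (hφ : Measurable φ) (ν : Measure ℂ) [SigmaFinite ν]
    (hν : ν Kᶜ = 0) {m : ℕ} (hm : m₀ ≤ m) (hm1 : 1 ≤ m) :
    normalizationConstant K ν Q (m + 1) ≤
      (∫⁻ z, φ z ∂ν) ^ (m + 1) * weightedDiameter K Q (m + 1) ^ ((m + 1) * m) := by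
  have hae := ae_pi_mem hν (m + 1)
  unfold normalizationConstant
  rw [Measure.restrict_eq_self_of_ae_mem hae, ← lintegral_pi_prod ν hφ,
    ← lintegral_mul_const (f := fun z : Fin (m + 1) → ℂ => ∏ i, φ (z i)) _ (Finset.measurable_fun_prod _ fun i _ =>
      hφ.comp (measurable_pi_apply i))]
  refine lintegral_mono_ae ?_
  filter_upwards [hae] with z hz
  rw [absVDM_sq]
  exact h.sqVDM_le_prod hm hm1 Finset.univ z hz

lemma measurable_sqVDM {Q : ℂ → EReal} (hQ : Measurable Q) (k : ℕ) :
    Measurable fun z : Fin k → ℂ => sqVDM Q z := by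
  have hw : Measurable (weight Q) := hQ.neg.ereal_exp
  refine Finset.measurable_fun_prod _ fun i _ => Finset.measurable_fun_prod _ fun j _ => ?_
  split_ifs
  · exact measurable_const
  · unfold pairKernel
    exact (((measurable_pi_apply i).edist (measurable_pi_apply j)).mul
      (hw.comp (measurable_pi_apply i))).mul (hw.comp (measurable_pi_apply j))

lemma bernsteinMarkov_prod {K : Set ℂ} {ν : Measure ℂ} (hν : ν Kᶜ = 0) {Q : ℂ → EReal}
    {m : ℕ} {M : ℝ≥0}
    (hM : ∀ p : Polynomial ℂ, p.natDegree ≤ m →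
      (⨆ z ∈ K, weight Q z ^ m * ‖p.eval z‖ₑ) ≤
        (M : ℝ≥0∞) * (∫⁻ z in K, (weight Q z ^ m * ‖p.eval z‖ₑ) ^ 2 ∂ν) ^ (1 / 2 : ℝ))
    (z : Fin m → ℂ) {x : ℂ} (hx : x ∈ K) :
    (weight Q x ^ m * ∏ j, edist x (z j)) ^ 2 ≤
      (M : ℝ≥0∞) ^ 2 * ∫⁻ y, (weight Q y ^ m * ∏ j, edist y (z j)) ^ 2 ∂ν := by
  set p : Polynomial ℂ := ∏ j, (Polynomial.X - Polynomial.C (z j)) with hp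
  have hdeg : p.natDegree ≤ m := by
    rw [hp, Polynomial.natDegree_prod_of_monic _ _ fun j _ => Polynomial.monic_X_sub_C _]
    simp
  have heval : ∀ y, ‖p.eval y‖ₑ = ∏ j, edist y (z j) := fun y => by
    rw [hp, Polynomial.eval_prod]
    simp only [Polynomial.eval_sub, Polynomial.eval_X, Polynomial.eval_C, edist_eq_enorm_sub,
      enorm_eq_nnnorm, nnnorm_prod, ENNReal.ofNNReal_finsetProd]
  have hr : ν.restrict K = ν := Measure.restrict_eq_self_of_ae_mem hν
  have h1 := (le_iSup₂ (f := fun y (_ : y ∈ K) => weight Q y ^ m * ‖p.eval y‖ₑ) x hx).trans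
    (hM p hdeg)
  simp only [heval, hr] at h1
  calc _ ≤ ((M : ℝ≥0∞) *
        (∫⁻ y, (weight Q y ^ m * ∏ j, edist y (z j)) ^ 2 ∂ν) ^ (1 / 2 : ℝ)) ^ 2 := by gcongr
    _ = _ := by
        rw [mul_pow, ← ENNReal.rpow_natCast (_ ^ (1 / 2 : ℝ)), ← ENNReal.rpow_mul]
        norm_num

/-- With m + 1 points, each variable sees degree m and weight power m, exactly as Bernstein–Markov
at level m requires. Each of the m + 1 variables costs M². -/
lemma sqVDM_le_normalizationConstant {K : Set ℂ} (hK : IsClosed K) {ν : Measure ℂ}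
    [SigmaFinite ν] (hν : ν Kᶜ = 0) {Q : ℂ → EReal} (hQ : IsWeight K Q) {m : ℕ} {M : ℝ≥0}
    (hM : ∀ p : Polynomial ℂ, p.natDegree ≤ m →
      (⨆ z ∈ K, weight Q z ^ m * ‖p.eval z‖ₑ) ≤
        (M : ℝ≥0∞) * (∫⁻ z in K, (weight Q z ^ m * ‖p.eval z‖ₑ) ^ 2 ∂ν) ^ (1 / 2 : ℝ))
    {z : Fin (m + 1) → ℂ} (hz : ∀ i, z i ∈ K) :
    sqVDM Q z ≤ ((M : ℝ≥0∞) ^ 2) ^ (m + 1) * normalizationConstant K ν Q (m + 1) := by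
  set f : (Fin (m + 1) → ℂ) → ℝ≥0∞ := fun z => sqVDM (extendTop K Q) z
  have hf : Measurable f := measurable_sqVDM (measurable_extendTop hK hQ.lsc) _
  have hfQ : ∀ y : Fin (m + 1) → ℂ, (∀ i, y i ∈ K) → f y = sqVDM Q y := fun y hy => by
    simp only [f, sqVDM, pairKernel, weight, extendTop_of_mem (hy _)]
  -- The set `s` records the coordinates already integrated out.
  have key : ∀ s : Finset (Fin (m + 1)), ∀ y : Fin (m + 1) → ℂ, (∀ i, y i ∈ K) →
      f y ≤ ((M : ℝ≥0∞) ^ 2) ^ s.card * lmarginal (fun _ => ν) s f y := by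
    intro s
    induction s using Finset.induction_on with
    | empty => intro y _; simp
    | insert i s hi ih =>
      intro y hy
      have hupd : ∀ x ∈ K, ∀ j, Function.update y i x j ∈ K := fun x hx j => by
        rcases eq_or_ne j i with rfl | hj
        · simpa using hx
        · simpa [hj] using hy j
      have hyi := sqVDM_update Q y i (y i)
      rw [Function.update_eq_self] at hyi
      rw [Finset.card_insert_of_notMem hi, lmarginal_insert _ hf hi]
      calc f y = coVDM Q y i * (weight Q (y i) ^ m * ∏ j, edist (y i) (y (i.succAbove j))) ^ 2 := by
            rw [hfQ y hy, hyi]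
        _ ≤ coVDM Q y i * ((M : ℝ≥0∞) ^ 2 *
              ∫⁻ x, (weight Q x ^ m * ∏ j, edist x (y (i.succAbove j))) ^ 2 ∂ν) := by
            gcongr
            exact bernsteinMarkov_prod hν hM _ (hy i)
        _ = (M : ℝ≥0∞) ^ 2 * ∫⁻ x, sqVDM Q (Function.update y i x) ∂ν := by
            simp only [sqVDM_update]
            rw [lintegral_const_mul' _ _ (coVDM_ne_top hQ hy i)]
            ring
        _ ≤ (M : ℝ≥0∞) ^ 2 * ∫⁻ x, ((M : ℝ≥0∞) ^ 2) ^ s.card *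
              lmarginal (fun _ => ν) s f (Function.update y i x) ∂ν := by
            gcongr 1
            refine lintegral_mono_ae ?_
            filter_upwards [(hν : ∀ᵐ x ∂ν, x ∈ K)] with x hx
            rw [← hfQ _ (hupd x hx)]
            exact ih _ (hupd x hx)
        _ = _ := by
            rw [lintegral_const_mul' _ _ (by finiteness), pow_succ']
            ring
  have := key Finset.univ z hz
  rwa [hfQ z hz, lmarginal_univ, ← normalizationConstant_eq K ν hν, Finset.card_univ,
    Fintype.card_fin] at this

/-! ### Passage to the limit. -/

lemma tendsto_const_rpow_one_div {B : ℝ≥0∞} (h0 : B ≠ 0) (hB : B ≠ ⊤) :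
    Tendsto (fun m : ℕ => B ^ (1 / (m : ℝ))) atTop (𝓝 1) := by
  lift B to ℝ≥0 using hB
  have hB0 : B ≠ 0 := by exact_mod_cast h0
  have h1 : Tendsto (fun m : ℕ => B ^ (1 / (m : ℝ))) atTop (𝓝 1) := by
    have := (tendsto_const_nhds (x := B)).nnrpow
      (tendsto_one_div_atTop_nhds_zero_nat (𝕜 := ℝ)) (Or.inl hB0)
    rwa [NNReal.rpow_zero] at this
  simp_rw [← ENNReal.coe_rpow_of_ne_zero hB0]
  exact (ENNReal.tendsto_coe (a := 1)).2 h1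

lemma tendsto_weightedDiameter {K : Set ℂ} {Q : ℂ → EReal} (hQ : IsWeight K Q) :
    Tendsto (fun k : ℕ => weightedDiameter K Q k) atTop (𝓝 (transfiniteDiameter K Q)) ∧
      transfiniteDiameter K Q = ⨅ m, weightedDiameter K Q (m + 2) := by
  -- For k = 0, 1 the exponent 2/(k(k-1)) is 2/0 = 0, so monotonicity starts at k = 2.
  have hanti : Antitone fun m : ℕ => weightedDiameter K Q (m + 2) :=
    antitone_nat_of_succ_le fun m =>
      weightedDiameter_succ_le K Q (by omega) fun z hz => sqVDM_ne_top hQ hz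
  have h := (tendsto_add_atTop_iff_nat (f := fun k => weightedDiameter K Q k) 2).1
    (tendsto_atTop_iInf hanti)
  have heq : transfiniteDiameter K Q = ⨅ m, weightedDiameter K Q (m + 2) := h.limsup_eq
  rw [heq]
  exact ⟨h, rfl⟩

lemma transfiniteDiameter_le {K : Set ℂ} {Q : ℂ → EReal} (hQ : IsWeight K Q) {m : ℕ}
    (hm : 1 ≤ m) : transfiniteDiameter K Q ≤ weightedDiameter K Q (m + 1) := by
  obtain ⟨m, rfl⟩ := Nat.exists_eq_add_of_le' hm
  rw [(tendsto_weightedDiameter hQ).2]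
  exact iInf_le _ m

lemma IsMajorant.normalizationConstant_rpow_le {K : Set ℂ} {Q : ℂ → EReal} {φ : ℂ → ℝ≥0∞}
    {m₀ : ℕ} (h : IsMajorant K Q φ m₀) (hφ : Measurable φ) (ν : Measure ℂ) [SigmaFinite ν]
    (hν : ν Kᶜ = 0) {m : ℕ} (hm : m₀ ≤ m) (hm1 : 1 ≤ m) :
    normalizationConstant K ν Q (m + 1) ^
        (1 / (((m + 1 : ℕ) : ℝ) * (((m + 1 : ℕ) : ℝ) - 1))) ≤
      (∫⁻ z, φ z ∂ν) ^ (1 / (m : ℝ)) * weightedDiameter K Q (m + 1) := by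
  have hm0 : (0 : ℝ) < m := by exact_mod_cast hm1
  rw [natCast_mul_sub_one, one_div, ENNReal.rpow_inv_le_iff (by positivity), ENNReal.rpow_natCast]
  refine (h.normalizationConstant_le hφ ν hν hm hm1).trans_eq ?_
  rw [mul_pow]
  congr 1
  rw [← ENNReal.rpow_natCast (_ ^ (1 / (m : ℝ))), ← ENNReal.rpow_mul, ← ENNReal.rpow_natCast]
  congr 1
  push_cast
  field_simp

lemma weightedDiameter_le_normalizationConstant {K : Set ℂ} (hK : IsClosed K) {ν : Measure ℂ}
    [SigmaFinite ν] (hν : ν Kᶜ = 0) {Q : ℂ → EReal} (hQ : IsWeight K Q) {m : ℕ} (hm : 1 ≤ m)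
    {M : ℝ≥0}
    (hM : ∀ p : Polynomial ℂ, p.natDegree ≤ m →
      (⨆ z ∈ K, weight Q z ^ m * ‖p.eval z‖ₑ) ≤
        (M : ℝ≥0∞) * (∫⁻ z in K, (weight Q z ^ m * ‖p.eval z‖ₑ) ^ 2 ∂ν) ^ (1 / 2 : ℝ)) :
    weightedDiameter K Q (m + 1) ≤ ((M : ℝ≥0∞) ^ (1 / (m : ℝ))) ^ 2 *
      normalizationConstant K ν Q (m + 1) ^
        (1 / (((m + 1 : ℕ) : ℝ) * (((m + 1 : ℕ) : ℝ) - 1))) := by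
  have hm0 : (0 : ℝ) < m := by exact_mod_cast hm
  refine weightedDiameter_le K Q hm _ fun z hz => ?_
  refine (sqVDM_le_normalizationConstant hK hν hQ hM hz).trans_eq ?_
  rw [natCast_mul_sub_one, mul_pow, ← pow_mul, ← pow_mul]
  congr 1
  · rw [← ENNReal.rpow_natCast (_ ^ (1 / (m : ℝ))), ← ENNReal.rpow_mul, ← ENNReal.rpow_natCast]
    congr 1
    push_cast
    field_simp
  · rw [one_div, ← ENNReal.rpow_natCast (_ ^ _), ENNReal.rpow_inv_rpow (by positivity)]

/-- The asymptotics of the normalization constants, given an integrable majorant. -/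
lemma tendsto_normalizationConstant {K : Set ℂ} (hK : IsClosed K) {ν : Measure ℂ}
    [SigmaFinite ν] (hν : ν Kᶜ = 0) {Q : ℂ → EReal} (hQ : IsWeight K Q)
    {φ : ℂ → ℝ≥0∞} {m₀ : ℕ} (hφ : Measurable φ) (hφint : ∫⁻ z, φ z ∂ν < ⊤) (hmaj : IsMajorant K Q φ m₀)
    (hBM : BernsteinMarkov K ν Q) :
    Tendsto (fun k : ℕ => normalizationConstant K ν Q k ^ (1 / ((k : ℝ) * ((k : ℝ) - 1))))
      atTop (𝓝 (transfiniteDiameter K Q)) := by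
  obtain ⟨M, hMlim, hM⟩ := hBM
  have hδ := (tendsto_add_atTop_iff_nat 1).2 (tendsto_weightedDiameter hQ).1
  rw [← tendsto_add_atTop_iff_nat 1, tendsto_order]
  refine ⟨fun a ha => ?_, fun a ha => ?_⟩
  -- Take c > 1 with a c² still below the limit; eventually M_m^{1/m} < c, so a root of Z_k at most
  -- a would be contradictory.
  · have hcont : ContinuousAt (fun c : ℝ≥0∞ => a * c ^ 2) 1 :=
      ENNReal.Tendsto.const_mul (ENNReal.continuous_pow 2).continuousAt (Or.inr (ne_top_of_lt ha))
    have hev : ∀ᶠ c : ℝ≥0∞ in 𝓝[>] 1, a * c ^ 2 < transfiniteDiameter K Q :=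
      nhdsWithin_le_nhds (hcont.eventually (gt_mem_nhds (by simpa using ha)))
    have hne : (𝓝[>] (1 : ℝ≥0∞)).NeBot := nhdsGT_neBot_of_exists_gt ⟨⊤, ENNReal.one_lt_top⟩
    obtain ⟨c, hc, hc1⟩ := (hev.and self_mem_nhdsWithin).exists
    have hMc : ∀ᶠ m in atTop, (M m : ℝ≥0∞) ^ (1 / (m : ℝ)) < c :=
      eventually_lt_of_limsup_lt (hMlim.trans_lt hc1)
    filter_upwards [hMc, eventually_ge_atTop 1] with m hm hm1
    set Z := normalizationConstant K ν Q (m + 1) ^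
        (1 / (((m + 1 : ℕ) : ℝ) * (((m + 1 : ℕ) : ℝ) - 1))) with hZ
    by_contra! hle
    have h1 : transfiniteDiameter K Q ≤ c ^ 2 * a :=
      calc transfiniteDiameter K Q ≤ weightedDiameter K Q (m + 1) := transfiniteDiameter_le hQ hm1
        _ ≤ ((M m : ℝ≥0∞) ^ (1 / (m : ℝ))) ^ 2 * Z :=
          weightedDiameter_le_normalizationConstant hK hν hQ hm1 (hM m)
        _ ≤ c ^ 2 * a := by gcongr
    exact absurd hc (not_lt.2 (by rwa [mul_comm] at h1))
  -- Adding 1 keeps the base nonzero, so that its m-th root tends to 1.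
  · have hB := tendsto_const_rpow_one_div (B := ∫⁻ z, φ z ∂ν + 1)
      (by simp) (ENNReal.add_ne_top.2 ⟨hφint.ne, ENNReal.one_ne_top⟩)
    have hprod := ENNReal.Tendsto.mul hB (Or.inl one_ne_zero) hδ (Or.inr ENNReal.one_ne_top)
    rw [one_mul] at hprod
    filter_upwards [hprod.eventually (gt_mem_nhds ha), eventually_ge_atTop m₀,
      eventually_ge_atTop 1] with m hm hm₀ hm1
    refine lt_of_le_of_lt (hmaj.normalizationConstant_rpow_le hφ ν hν hm₀ hm1) (lt_of_le_of_lt ?_ hm)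
    gcongr
    exact le_self_add

lemma transfiniteDiameter_pos {K : Set ℂ} (hK : IsClosed K) {Q : ℂ → EReal}
    (hQ : IsWeight K Q) : 0 < transfiniteDiameter K Q := by
  obtain ⟨c, hc, h⟩ := exists_weightedDiameter_ge hK hQ
  rw [(tendsto_weightedDiameter hQ).2]
  exact hc.trans_le (le_iInf fun m => h (m + 1) (by omega))

lemma transfiniteDiameter_lt_top {K : Set ℂ} (hK : IsClosed K) {Q : ℂ → EReal}
    (hQ : IsWeight K Q)
    (h : ∃ (C : ℝ≥0∞) (R : ℝ), C ≠ ⊤ ∧ ∀ z ∈ K, R ≤ ‖z‖ → weight Q z * ‖z‖ₑ ≤ C) :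
    transfiniteDiameter K Q < ⊤ := by
  obtain ⟨C, hC, hCw⟩ := exists_weight_bound hK hQ h
  exact ((transfiniteDiameter_le hQ le_rfl).trans (weightedDiameter_le_sq hCw le_rfl)).trans_lt
    (ENNReal.pow_ne_top hC).lt_top

lemma ControlsAtInfinity.exists_weight_le_const {K : Set ℂ} {ν : Measure ℂ} {Q : ℂ → EReal}
    {ε : ℂ → ℝ≥0} (h : ControlsAtInfinity K ν Q ε) :
    ∃ (C : ℝ≥0∞) (R : ℝ), C ≠ ⊤ ∧ ∀ z ∈ K, R ≤ ‖z‖ → weight Q z * ‖z‖ₑ ≤ C := by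
  obtain ⟨R₁, hR₁⟩ := h.exists_weight_le
  obtain ⟨R₂, hR₂⟩ := eventually_atInfinity
    (h.tendsto_zero.eventually (gt_mem_nhds (zero_lt_one (α := ℝ≥0))))
  refine ⟨1, max R₁ R₂, ENNReal.one_ne_top, fun z hz hzR => ?_⟩
  refine (hR₁ z hz ((le_max_left _ _).trans hzR)).trans ?_
  exact_mod_cast (hR₂ z hz ((le_max_right _ _).trans hzR)).le

end WeightedPotential

end

theorem proposition9p2 (K : Set ℂ) (hKclosed : IsClosed K)
    (hKnonpolar : ¬ WeightedPotential.IsPolar K)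
    (ν : MeasureTheory.Measure ℂ) [MeasureTheory.IsLocallyFiniteMeasure ν] (hν : ν Kᶜ = 0)
    (Q : ℂ → EReal) (hQ : WeightedPotential.IsWeight K Q)
    (hcases :
      (ν Set.univ < ⊤ ∧ WeightedPotential.WeaklyAdmissible K Q) ∨
      ((∀ R : ℝ, ν {z ∈ K | R < ‖z‖} = ⊤) ∧
        ∃ ε : ℂ → ℝ≥0, WeightedPotential.ControlsAtInfinity K ν Q ε))
    (hBM : WeightedPotential.BernsteinMarkov K ν Q) :
    (0 < WeightedPotential.transfiniteDiameter K Q ∧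
      WeightedPotential.transfiniteDiameter K Q < ⊤) ∧
    Filter.Tendsto (fun k : ℕ => WeightedPotential.weightedDiameter K Q k) Filter.atTop
      (𝓝 (WeightedPotential.transfiniteDiameter K Q)) ∧
    Filter.Tendsto
      (fun k : ℕ => WeightedPotential.normalizationConstant K ν Q k ^
        (1 / ((k : ℝ) * ((k : ℝ) - 1))))
      Filter.atTop (𝓝 (WeightedPotential.transfiniteDiameter K Q)) := by
  have hfin : WeightedPotential.transfiniteDiameter K Q < ⊤ := by
    refine WeightedPotential.transfiniteDiameter_lt_top hKclosed hQ ?_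
    rcases hcases with ⟨-, hwa⟩ | ⟨-, ε, hε⟩
    · exact hwa.exists_weight_le
    · exact hε.exists_weight_le_const
  refine ⟨⟨WeightedPotential.transfiniteDiameter_pos hKclosed hQ, hfin⟩,
    (WeightedPotential.tendsto_weightedDiameter hQ).1, ?_⟩
  rcases hcases with ⟨hmass, -⟩ | ⟨-, ε, hε⟩
  · exact WeightedPotential.tendsto_normalizationConstant hKclosed hν hQ
      measurable_const (by simpa using hmass) (WeightedPotential.isMajorant_one K Q) hBM
  · obtain ⟨φ, m₀, hφ, hint, hmaj⟩ := hε.exists_isMajorant hKclosed hν hQ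
    exact WeightedPotential.tendsto_normalizationConstant hKclosed hν hQ hφ hint hmaj hBM
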